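/- Let $H\subset \mathrm{SL}(3,\mathbb R)$ be the Heisenberg group of unipotent upper-triangular matrices, and let $\theta:H\to \mathrm{SL}(10,\mathbb R)$ be the homomorphism $$ \theta\begin{pmatrix}1&a&c\\0&1&b\\0&0&1\end{pmatrix} =\begin{pmatrix} 1&2a&2c&a&a^2/2&a^3/6&b&2a^2+b^2/2&b^3/6+2ac&(a^4+b^4)/24+c^2\\ 0&1&b&0&0&0&0&2a&ab+c&bc\\ 0&0&1&0&0&0&0&0&a&c\\ 0&0&0&1&a&a^2/2&0&0&0&a^3/6\\ 0&0&0&0&1&a&0&0&0&a^2/2\\ 0&0&0&0&0&1&0&0&0&a\\ 0&0&0&0&0&0&1&b&b^2/2&b^3/6\\ 0&0&0&0&0&0&0&1&b&b^2/2\\ 0&0&0&0&0&0&0&0&1&b\\ 0&0&0&0&0&0&0&0&0&1 \end{pmatrix}, $$ with image $G=\theta(H)$. Call a nonempty open set $\Omega\subset\mathbb{RP}^9$ a strictly convex domain if its closure is disjoint from some projective hyperplane, $\Omega$ is convex in the affine patch complementary to that hyperplane, and the boundary $\partial\Omega$ contains no nondegenerate projective line segment. Then $\theta$ is injective, and there is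 a strictly convex domain $\Omega\subset\mathbb{RP}^9$ such that: 1. $g(\Omega)=\Omega$ for every $g\in G$; 2. the resulting action of $H$ on $\Omega$ is effective: if $h\in H$ and $\theta(h)$ fixes every point of $\Omega$, then $h=1$; 3. for every $h\in H$, the matrix $\theta(h)$ is unipotent (that is, $\theta(h)-I$ is nilpotent) and acts on $\Omega$ as an isometry of the Hilbert metric $d_\Omega$; 4. for every $h\in H$ with $h\neq 1$, $\theta(h)$ acts on $\Omega$ as a parabolic isometry: it fixes no point of $\Omega$, all its complex eigenvalues have modulus $1$, and its translation length $\inf_{x\in\Omega}d_\Omega(x,\theta(h)x)$ is $0$. -/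

import Mathlib

open scoped LinearAlgebra.Projectivization MatrixGroups Pointwise

/-! ### The Heisenberg group and its ten-dimensional representation -/

/-- The real Heisenberg group: the subgroup of `SL(3, ℝ)` of unipotent upper-triangular
matrices. -/
def heisenbergGroup : Subgroup SL(3, ℝ) where
  carrier := {A | (∀ i, A i i = 1) ∧ ∀ i j, j < i → A i j = 0}
  one_mem' := by
    refine ⟨fun i => by simp, fun i j hij => ?_⟩
    simp [Matrix.one_apply_ne hij.ne']
  mul_mem' := by
    rintro A B ⟨hA, hA'⟩ ⟨hB, hB'⟩
    have a1 := hA' 1 0 (by decide)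
    have a2 := hA' 2 0 (by decide)
    have a3 := hA' 2 1 (by decide)
    have b1 := hB' 1 0 (by decide)
    have b2 := hB' 2 0 (by decide)
    have b3 := hB' 2 1 (by decide)
    refine ⟨fun i => ?_, fun i j hij => ?_⟩
    · fin_cases i <;>
        simp [Matrix.mul_apply, Fin.sum_univ_three, hA, hB, a1, a2, a3, b1, b2, b3]
    · fin_cases i <;> fin_cases j <;> first
        | exact absurd hij (by decide)
        | simp [Matrix.mul_apply, Fin.sum_univ_three, hA, hB, a1, a2, a3, b1, b2, b3]
  inv_mem' := by
    rintro A ⟨hA, hA'⟩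
    have a1 := hA' 1 0 (by decide)
    have a2 := hA' 2 0 (by decide)
    have a3 := hA' 2 1 (by decide)
    refine ⟨fun i => ?_, fun i j hij => ?_⟩
    · fin_cases i <;>
        simp [Matrix.SpecialLinearGroup.coe_inv, Matrix.adjugate_fin_three, hA, a1, a2, a3]
    · fin_cases i <;> fin_cases j <;> first
        | exact absurd hij (by decide)
        | simp [Matrix.SpecialLinearGroup.coe_inv, Matrix.adjugate_fin_three, hA, a1, a2, a3]

/-- The `10 × 10` matrix assigned to the Heisenberg matrix with entries `a` (row 1, column 2),
`b` (row 2, column 3) and `c` (row 1, column 3). -/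
noncomputable def thetaMatrix (a b c : ℝ) : Matrix (Fin 10) (Fin 10) ℝ :=
  !![1, 2 * a, 2 * c, a, a ^ 2 / 2, a ^ 3 / 6, b, 2 * a ^ 2 + b ^ 2 / 2, b ^ 3 / 6 + 2 * a * c,
      (a ^ 4 + b ^ 4) / 24 + c ^ 2;
    0, 1, b, 0, 0, 0, 0, 2 * a, a * b + c, b * c;
    0, 0, 1, 0, 0, 0, 0, 0, a, c;
    0, 0, 0, 1, a, a ^ 2 / 2, 0, 0, 0, a ^ 3 / 6;
    0, 0, 0, 0, 1, a, 0, 0, 0, a ^ 2 / 2;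
    0, 0, 0, 0, 0, 1, 0, 0, 0, a;
    0, 0, 0, 0, 0, 0, 1, b, b ^ 2 / 2, b ^ 3 / 6;
    0, 0, 0, 0, 0, 0, 0, 1, b, b ^ 2 / 2;
    0, 0, 0, 0, 0, 0, 0, 0, 1, b;
    0, 0, 0, 0, 0, 0, 0, 0, 0, 1]

theorem thetaMatrix_det (a b c : ℝ) : (thetaMatrix a b c).det = 1 := by
  rw [Matrix.det_of_isUpperTriangular]
  · simp [Fin.prod_univ_succ, thetaMatrix]
  · intro i j hij
    fin_cases i <;> fin_cases j <;> first
      | exact absurd hij (by decide)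
      | rfl

theorem thetaMatrix_zero : thetaMatrix 0 0 0 = 1 := by
  ext i j
  fin_cases i <;> fin_cases j <;> simp [thetaMatrix]

set_option maxHeartbeats 4000000 in
theorem thetaMatrix_mul (a b c x y z : ℝ) :
    thetaMatrix a b c * thetaMatrix x y z = thetaMatrix (a + x) (b + y) (c + z + a * y) := by
  ext i j
  rw [Matrix.mul_apply]
  fin_cases i <;> fin_cases j <;> simp [thetaMatrix, Fin.sum_univ_succ] <;> ring

/-- The representation `θ : H → SL(10, ℝ)` of the Heisenberg group. -/
noncomputable def theta : heisenbergGroup →* SL(10, ℝ) where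
  toFun h := ⟨thetaMatrix (h.1 0 1) (h.1 1 2) (h.1 0 2), thetaMatrix_det _ _ _⟩
  map_one' := by
    apply Subtype.ext
    simpa using thetaMatrix_zero
  map_mul' := by
    rintro ⟨A, hA, hA'⟩ ⟨B, hB, hB'⟩
    apply Subtype.ext
    have b1 := hB' 2 1 (by decide)
    have a1 := hA' 1 0 (by decide)
    refine Eq.trans ?_ (thetaMatrix_mul _ _ _ _ _ _).symm
    simp [Matrix.mul_apply, Fin.sum_univ_three, hA, hB, a1, b1]
    ring_nf

/-! ### Convex domains in real projective space -/

/-- Real projective space carries the quotient topology. -/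
noncomputable instance projectiveTopology (n : ℕ) : TopologicalSpace (ℙ ℝ (Fin n → ℝ)) :=
  TopologicalSpace.coinduced (Projectivization.mk' ℝ) inferInstance

/-- A properly convex domain: a nonempty open subset of projective space whose closure is
disjoint from some hyperplane `φ = 0` and which is a convex set in the affine patch
`φ = 1` complementary to that hyperplane. -/
def IsProperlyConvexDomain {n : ℕ} (Ω : Set (ℙ ℝ (Fin n → ℝ))) : Prop :=
  IsOpen Ω ∧ Ω.Nonempty ∧
    ∃ φ : (Fin n → ℝ) →ₗ[ℝ] ℝ,
      (∀ (v : Fin n → ℝ) (hv : v ≠ 0), Projectivization.mk ℝ v hv ∈ closure Ω → φ v ≠ 0) ∧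
      Convex ℝ {v : Fin n → ℝ | φ v = 1 ∧ ∃ hv : v ≠ 0, Projectivization.mk ℝ v hv ∈ Ω}

/-- The projective segment `{[s v + t w] : s, t ≥ 0, (s, t) ≠ (0, 0)}` with end points `[v]` and
`[w]`, where `v` and `w` are linearly independent. Replacing `w` by `-w` gives the other segment
with the same end points. -/
def projectiveSegment {n : ℕ} (v w : Fin n → ℝ) : Set (ℙ ℝ (Fin n → ℝ)) :=
  {p | ∃ s t : ℝ, 0 ≤ s ∧ 0 ≤ t ∧
    ∃ h : s • v + t • w ≠ 0, p = Projectivization.mk ℝ (s • v + t • w) h}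

/-- A strictly convex domain: a properly convex domain whose boundary contains no
nondegenerate projective segment. -/
def IsStrictlyConvexDomain {n : ℕ} (Ω : Set (ℙ ℝ (Fin n → ℝ))) : Prop :=
  IsProperlyConvexDomain Ω ∧
    ∀ v w : Fin n → ℝ, LinearIndependent ℝ ![v, w] → ¬ projectiveSegment v w ⊆ frontier Ω

/-! ### The Hilbert metric and parabolic isometries -/

/-- The Hilbert metric of a properly convex domain `Ω`. For distinct points `x = [u]`, `y = [v]`
of `Ω` the line through them meets the boundary of `Ω` in exactly two points `[s u + t v]` and
`[s' u + t' v]`, and the cross-ratio of these with `x` and `y` is `s t' / (t s')`; the distance is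
half the absolute value of the logarithm of the absolute value of this cross-ratio. The set below
then has exactly one element. For `x = y` it is empty, and the distance is `sSup ∅ = 0`. -/
noncomputable def hilbertDist {n : ℕ} (Ω : Set (ℙ ℝ (Fin n → ℝ))) (x y : ℙ ℝ (Fin n → ℝ)) : ℝ :=
  sSup {r : ℝ | ∃ (u v : Fin n → ℝ) (hu : u ≠ 0) (hv : v ≠ 0),
    x = Projectivization.mk ℝ u hu ∧ y = Projectivization.mk ℝ v hv ∧ x ≠ y ∧
    ∃ (s t s' t' : ℝ) (h : s • u + t • v ≠ 0) (h' : s' • u + t' • v ≠ 0),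
      Projectivization.mk ℝ _ h ∈ frontier Ω ∧ Projectivization.mk ℝ _ h' ∈ frontier Ω ∧
      Projectivization.mk ℝ _ h ≠ Projectivization.mk ℝ _ h' ∧
      r = 1 / 2 * |Real.log (abs ((s * t') / (t * s')))|}

/-- `g`, which is assumed to map `Ω` to itself, preserves the Hilbert metric of `Ω`. -/
def IsHilbertIsometry {n : ℕ} (Ω : Set (ℙ ℝ (Fin n → ℝ))) (g : SL(n, ℝ)) : Prop :=
  ∀ x ∈ Ω, ∀ y ∈ Ω, hilbertDist Ω (g • x) (g • y) = hilbertDist Ω x y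

/-- A projective transformation preserving `Ω` is parabolic if it fixes no point of `Ω`, all its
(complex) eigenvalues have modulus one, and it has translation length zero, that is,
the infimum over `x` in `Ω` of the Hilbert distance from `x` to `g x` is zero. -/
def IsParabolic {n : ℕ} (Ω : Set (ℙ ℝ (Fin n → ℝ))) (g : SL(n, ℝ)) : Prop :=
  (∀ x ∈ Ω, g • x ≠ x) ∧
    (∀ z ∈ spectrum ℂ ((g : Matrix (Fin n) (Fin n) ℝ).map (algebraMap ℝ ℂ)), ‖z‖ = 1) ∧
    IsGLB ((fun x => hilbertDist Ω x (g • x)) '' Ω) 0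

/-- A matrix is unipotent if it differs from the identity by a nilpotent matrix. -/
def IsUnipotentMatrix {n : ℕ} (g : SL(n, ℝ)) : Prop :=
  IsNilpotent ((g : Matrix (Fin n) (Fin n) ℝ) - 1)

/-! ### A strictly convex function invariant under the Heisenberg group -/

/-! The group fixes the first basis vector `e₀` and the functional `v 9`, so it acts affinely on the
patch `v 9 = 1`. There the convex function `f = seedFunction` is replaced by its supremum `F =
orbitSup` over the orbit, which is convex and invariant; the domain is `{F < 0}`.

The supremum is finite because of weights: with `a`, `b` of weight one and `c` of weight two, the
top right entry `(a^4 + b^4)/24 + c^2` is positive of weight four, while all other entries have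
weight at most three. An exponent `p < 4/3` keeps `∑ |v i|^p` below weight four, so `-v 0` dominates
and `f` tends to `-∞` along every orbit; hence `F` is an attained maximum
(`exists_isMax_seedFunction`).

The condition `p > 1` gives strictness in the eight middle coordinates, and `F (v + k e₀) = F v - k`
handles the remaining direction, so level sets of `F` contain no segment (`orbitSup_midpoint_lt`).
It also makes the epigraph superlinear, so `[e₀]` is the only possible boundary point at infinity
(`EpigraphBound.eq_single_zero`).

A fixed vector with `v 9 ≠ 0` forces `a = b = c = 0`. Moving a point along `e₀` leaves its
displacement vector unchanged but places ever longer segments in that direction inside the domain,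
so the translation length is zero (`hilbertDist_mk_le`). -/

theorem abs_rpow_convex_comb_le {p : ℝ} (hp : 1 < p) {x y α β : ℝ} (hα : 0 ≤ α) (hβ : 0 ≤ β)
    (hαβ : α + β = 1) : |α * x + β * y| ^ p ≤ α * |x| ^ p + β * |y| ^ p := by
  have h1 : |α * x + β * y| ≤ α * |x| + β * |y| := by
    refine (abs_add_le _ _).trans ?_
    rw [abs_mul, abs_mul, abs_of_nonneg hα, abs_of_nonneg hβ]
  calc |α * x + β * y| ^ p ≤ (α * |x| + β * |y|) ^ p :=
        Real.rpow_le_rpow (abs_nonneg _) h1 (by linarith)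
    _ ≤ α * |x| ^ p + β * |y| ^ p := by
        simpa using (convexOn_rpow hp.le).2 (Set.mem_Ici.2 (abs_nonneg x))
          (Set.mem_Ici.2 (abs_nonneg y)) hα hβ hαβ

/-- The power is strictly convex only on the half-line, so equal absolute values are treated apart:
then `x = -y` and the midpoint is `0`. -/
theorem abs_rpow_midpoint_lt {p : ℝ} (hp : 1 < p) {x y : ℝ} (hxy : x ≠ y) :
    |1 / 2 * x + 1 / 2 * y| ^ p < 1 / 2 * |x| ^ p + 1 / 2 * |y| ^ p := by
  by_cases h : |x| = |y|
  · obtain h | rfl := abs_eq_abs.1 h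
    · exact absurd h hxy
    · have hy : y ≠ 0 := by
        rintro rfl
        simp at hxy
      have : 0 < |y| ^ p := Real.rpow_pos_of_pos (abs_pos.2 hy) _
      have h0 : 1 / 2 * -y + 1 / 2 * y = 0 := by ring
      rw [h0, abs_zero, Real.zero_rpow (by linarith), abs_neg]
      linarith
  · have h1 : |1 / 2 * x + 1 / 2 * y| ≤ 1 / 2 * |x| + 1 / 2 * |y| := by
      refine (abs_add_le _ _).trans ?_
      rw [abs_mul, abs_mul, abs_of_nonneg (by norm_num : (0 : ℝ) ≤ 1 / 2)]
    calc |1 / 2 * x + 1 / 2 * y| ^ p ≤ (1 / 2 * |x| + 1 / 2 * |y|) ^ p :=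
          Real.rpow_le_rpow (abs_nonneg _) h1 (by linarith)
      _ < 1 / 2 * |x| ^ p + 1 / 2 * |y| ^ p := by
          simpa using (strictConvexOn_rpow hp).2 (Set.mem_Ici.2 (abs_nonneg x))
            (Set.mem_Ici.2 (abs_nonneg y)) h (by norm_num : (0 : ℝ) < 1 / 2)
            (by norm_num : (0 : ℝ) < 1 / 2) (by norm_num)

/-- A defining function, on the affine patch `v 9 = 1`, of a convex domain whose only point at
infinity is the first basis vector: the epigraph of `∑ |v i| ^ (5 / 4)`. The exponent lies strictly
between `1` and `4 / 3`. -/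
noncomputable def seedFunction (v : Fin 10 → ℝ) : ℝ :=
  ∑ i : Fin 8, |v i.castSucc.succ| ^ (5 / 4 : ℝ) - v 0

/-- The supremum of the defining function over the orbit of a vector. -/
noncomputable def orbitSup (v : Fin 10 → ℝ) : ℝ :=
  ⨆ g : ℝ × ℝ × ℝ, seedFunction ((thetaMatrix g.1 g.2.1 g.2.2).mulVec v)

theorem continuous_seedFunction : Continuous seedFunction := by
  unfold seedFunction
  refine (continuous_finsetSum _ fun i _ => ?_).sub (continuous_apply _)
  exact (continuous_apply _).abs.rpow_const fun _ => Or.inr (by norm_num)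

theorem seedFunction_convex_comb_le (v w : Fin 10 → ℝ) {α β : ℝ} (hα : 0 ≤ α) (hβ : 0 ≤ β)
    (hαβ : α + β = 1) :
    seedFunction (α • v + β • w) ≤ α * seedFunction v + β * seedFunction w := by
  have := Finset.sum_le_sum fun (i : Fin 8) (_ : i ∈ Finset.univ) =>
    abs_rpow_convex_comb_le (p := 5 / 4) (by norm_num) (x := v i.castSucc.succ)
      (y := w i.castSucc.succ) hα hβ hαβ
  rw [Finset.sum_add_distrib, ← Finset.mul_sum, ← Finset.mul_sum] at this
  simp only [seedFunction, Pi.add_apply, Pi.smul_apply, smul_eq_mul]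
  linarith

theorem seedFunction_midpoint_lt {v w : Fin 10 → ℝ} {i : Fin 8}
    (h : v i.castSucc.succ ≠ w i.castSucc.succ) :
    seedFunction ((1 / 2 : ℝ) • v + (1 / 2 : ℝ) • w) <
      1 / 2 * seedFunction v + 1 / 2 * seedFunction w := by
  have := Finset.sum_lt_sum (s := Finset.univ) (fun (j : Fin 8) _ =>
    abs_rpow_convex_comb_le (p := 5 / 4) (by norm_num) (x := v j.castSucc.succ)
      (y := w j.castSucc.succ) (α := 1 / 2) (β := 1 / 2) (by norm_num) (by norm_num) (by norm_num))
    ⟨i, Finset.mem_univ i, abs_rpow_midpoint_lt (by norm_num) h⟩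
  rw [Finset.sum_add_distrib, ← Finset.mul_sum, ← Finset.mul_sum] at this
  simp only [seedFunction, Pi.add_apply, Pi.smul_apply, smul_eq_mul]
  linarith

/-- Giving `a` and `b` weight one and `c` weight two, every entry of the representation other than
the top right one has weight at most three. -/
theorem abs_thetaMatrix_le {a b c N : ℝ} (hN : 1 ≤ N) (ha : |a| ≤ N) (hb : |b| ≤ N)
    (hc : |c| ≤ N ^ 2) {i j : Fin 10} (hij : (i, j) ≠ (0, 9)) :
    |thetaMatrix a b c i j| ≤ 3 * N ^ 3 := by
  have hN0 : 0 ≤ N := zero_le_one.trans hN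
  have h1 : 1 ≤ N ^ 3 := one_le_pow₀ hN
  have hN1 : N ≤ N ^ 3 := le_self_pow₀ hN (by norm_num)
  have hN2 : N ^ 2 ≤ N ^ 3 := pow_le_pow_right₀ hN (by norm_num)
  have hmul : ∀ {x y : ℝ}, |x| ≤ N → |y| ≤ N ^ 2 → |x * y| ≤ N ^ 3 := fun {x y} hx hy => by
    rw [abs_mul]
    calc |x| * |y| ≤ N * N ^ 2 := mul_le_mul hx hy (abs_nonneg _) hN0
      _ = N ^ 3 := by ring
  have hpow : ∀ {x : ℝ} (k : ℕ), |x| ≤ N → |x ^ k| ≤ N ^ k := fun {x} k hx => by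
    rw [abs_pow]
    exact pow_le_pow_left₀ (abs_nonneg _) hx k
  have hb' : |b| ≤ N ^ 2 := hb.trans (le_self_pow₀ hN (by norm_num))
  have a1 := abs_le.1 (ha.trans hN1)
  have a2 := abs_le.1 ((hpow 2 ha).trans hN2)
  have a3 := abs_le.1 (hpow 3 ha)
  have b1 := abs_le.1 (hb.trans hN1)
  have b2 := abs_le.1 ((hpow 2 hb).trans hN2)
  have b3 := abs_le.1 (hpow 3 hb)
  have c1 := abs_le.1 (hc.trans hN2)
  have ab := abs_le.1 (hmul ha hb')
  have ac := abs_le.1 (hmul ha hc)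
  have bc := abs_le.1 (hmul hb hc)
  have ht : 0 ≤ 3 * N ^ 3 := by linarith
  have ht1 : 1 ≤ 3 * N ^ 3 := by linarith
  fin_cases i <;> fin_cases j <;> first
    | exact absurd rfl hij
    | simpa [thetaMatrix] using ht
    | simpa [thetaMatrix] using ht1
    | (simp only [thetaMatrix, Matrix.of_apply, Matrix.cons_val', Matrix.cons_val,
        Fin.zero_eta, Fin.mk_one, Fin.reduceFinMk]
       rw [abs_le]
       constructor <;> linarith)

theorem continuous_thetaMatrix :
    Continuous fun g : ℝ × ℝ × ℝ => thetaMatrix g.1 g.2.1 g.2.2 := by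
  refine continuous_matrix fun i j => ?_
  fin_cases i <;> fin_cases j <;> simp [thetaMatrix] <;> fun_prop

/-- In terms of `K`, the parameters `a`, `b` are bounded by `K^4` and `c` by `K^8`. Degree 16 makes
the bound `(K^12)^(5/4) = K^15` an integer power, to be beaten by the top right term of order
`K^16`. -/
theorem seedFunction_thetaMatrix_le (v : Fin 10 → ℝ) (hv : 0 < v 9) :
    ∃ A B : ℝ, ∀ (g : ℝ × ℝ × ℝ) (K : ℝ), 1 ≤ K → K ^ 16 = 1 + g.1 ^ 4 + g.2.1 ^ 4 + g.2.2 ^ 2 →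
      seedFunction ((thetaMatrix g.1 g.2.1 g.2.2).mulVec v) ≤
        K ^ 15 * (A - v 9 / 24 * K) + B := by
  set C : ℝ := ∑ j, 3 * |v j| with hC
  have hC0 : 0 ≤ C := Finset.sum_nonneg fun j _ => by positivity
  -- The eight middle coordinates give `8 * C ^ (5 / 4)`, the rest of the top row gives `C`, and `v
  -- 9 / 24` absorbs the `1` in `K^16 = 1 + ...`.
  refine ⟨8 * C ^ (5 / 4 : ℝ) + C, v 9 / 24, ?_⟩
  rintro ⟨a, b, c⟩ K hK hM
  dsimp only at hM ⊢
  have hK0 : 0 ≤ K := zero_le_one.trans hK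
  have ha4 := Even.pow_nonneg (show Even 4 by decide) a
  have hb4 := Even.pow_nonneg (show Even 4 by decide) b
  have hc2 := sq_nonneg c
  have hroot : ∀ {x : ℝ}, x ^ 4 ≤ K ^ 16 → |x| ≤ K ^ 4 := fun {x} hx => by
    refine le_of_pow_le_pow_left₀ (n := 4) (by norm_num) (by positivity) ?_
    rw [← abs_pow, abs_of_nonneg (Even.pow_nonneg (by decide) x)]
    calc x ^ 4 ≤ K ^ 16 := hx
      _ = (K ^ 4) ^ 4 := by ring
  have ha : |a| ≤ K ^ 4 := hroot (by linarith)
  have hb : |b| ≤ K ^ 4 := hroot (by linarith)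
  have hc : |c| ≤ (K ^ 4) ^ 2 := by
    refine abs_le_of_sq_le_sq ?_ (by positivity)
    calc c ^ 2 ≤ K ^ 16 := by linarith
      _ = ((K ^ 4) ^ 2) ^ 2 := by ring
  have hent : ∀ i j, (i, j) ≠ (0, 9) → |thetaMatrix a b c i j| ≤ 3 * K ^ 12 := fun i j hij => by
    have := abs_thetaMatrix_le (one_le_pow₀ hK) ha hb hc hij
    rwa [← pow_mul] at this
  have hrow : ∀ i, i ≠ 0 → |(thetaMatrix a b c).mulVec v i| ≤ C * K ^ 12 := fun i hi => by
    rw [Matrix.mulVec, dotProduct, hC, Finset.sum_mul]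
    refine (Finset.abs_sum_le_sum_abs _ _).trans (Finset.sum_le_sum fun j _ => ?_)
    rw [abs_mul]
    calc _ ≤ 3 * K ^ 12 * |v j| :=
          mul_le_mul_of_nonneg_right (hent i j fun h => hi (Prod.ext_iff.1 h).1) (abs_nonneg _)
      _ = _ := by ring
  have htop : |(thetaMatrix a b c).mulVec v 0 - ((a ^ 4 + b ^ 4) / 24 + c ^ 2) * v 9| ≤
      C * K ^ 12 := by
    have hsplit : (thetaMatrix a b c).mulVec v 0 - ((a ^ 4 + b ^ 4) / 24 + c ^ 2) * v 9 =
        ∑ j : Fin 9, thetaMatrix a b c 0 j.castSucc * v j.castSucc := by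
      rw [Matrix.mulVec, dotProduct, Fin.sum_univ_castSucc]
      simp [thetaMatrix]
    rw [hsplit, hC, Finset.sum_mul, Fin.sum_univ_castSucc (n := 9) fun j => 3 * |v j| * K ^ 12]
    refine le_add_of_le_of_nonneg ((Finset.abs_sum_le_sum_abs _ _).trans
      (Finset.sum_le_sum fun j _ => ?_)) (by positivity)
    rw [abs_mul]
    calc _ ≤ 3 * K ^ 12 * |v j.castSucc| :=
          mul_le_mul_of_nonneg_right (hent 0 _ fun h =>
            (Fin.castSucc_lt_last j).ne (Prod.ext_iff.1 h).2) (abs_nonneg _)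
      _ = _ := by ring
  have hpow : ∀ i : Fin 8, |(thetaMatrix a b c).mulVec v i.castSucc.succ| ^ (5 / 4 : ℝ) ≤
      C ^ (5 / 4 : ℝ) * K ^ 15 := fun i => by
    refine (Real.rpow_le_rpow (abs_nonneg _) (hrow _ (Fin.succ_ne_zero _)) (by norm_num)).trans_eq ?_
    rw [Real.mul_rpow hC0 (by positivity), ← Real.rpow_natCast_mul hK0]
    norm_num
  have hsum := Finset.sum_le_card_nsmul Finset.univ _ _ fun i _ => hpow i
  simp only [Finset.card_univ, Fintype.card_fin, nsmul_eq_mul, Nat.cast_ofNat] at hsum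
  have h1215 : C * K ^ 12 ≤ C * K ^ 15 :=
    mul_le_mul_of_nonneg_left (pow_le_pow_right₀ hK (by norm_num)) hC0
  have hq : (K ^ 16 - 1) / 24 * v 9 ≤ ((a ^ 4 + b ^ 4) / 24 + c ^ 2) * v 9 :=
    mul_le_mul_of_nonneg_right (by linarith) hv.le
  have := (abs_le.1 htop).1
  have hexp : K ^ 15 * (8 * C ^ (5 / 4 : ℝ) + C - v 9 / 24 * K) + v 9 / 24 =
      8 * (C ^ (5 / 4 : ℝ) * K ^ 15) + C * K ^ 15 - (K ^ 16 - 1) / 24 * v 9 := by ring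
  rw [hexp, seedFunction]
  linarith

theorem tendsto_seedFunction_thetaMatrix (v : Fin 10 → ℝ) (hv : 0 < v 9) :
    Filter.Tendsto (fun g : ℝ × ℝ × ℝ => seedFunction ((thetaMatrix g.1 g.2.1 g.2.2).mulVec v))
      (Filter.cocompact _) Filter.atBot := by
  obtain ⟨A, B, h⟩ := seedFunction_thetaMatrix_le v hv
  set M : ℝ × ℝ × ℝ → ℝ := fun g => 1 + g.1 ^ 4 + g.2.1 ^ 4 + g.2.2 ^ 2 with hMdef
  have h4 : ∀ x : ℝ, 0 ≤ x ^ 4 ∧ |x| ≤ 1 + x ^ 4 := fun x => by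
    refine ⟨Even.pow_nonneg (by decide) x, abs_le.2 ⟨?_, ?_⟩⟩ <;>
      nlinarith [sq_nonneg (x ^ 2 - 1), sq_nonneg (x - 1), sq_nonneg (x + 1)]
  have h2 : ∀ x : ℝ, |x| ≤ 1 + x ^ 2 := fun x =>
    abs_le.2 ⟨by nlinarith [sq_nonneg (x + 1)], by nlinarith [sq_nonneg (x - 1)]⟩
  have hM1 : ∀ g, 1 ≤ M g := fun g => by
    have := (h4 g.1).1
    have := (h4 g.2.1).1
    have := sq_nonneg g.2.2
    simp only [hMdef]
    linarith
  have hnorm : ∀ g, ‖g‖ ≤ M g := fun g => by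
    have := h4 g.1
    have := h4 g.2.1
    have := sq_nonneg g.2.2
    have := h2 g.2.2
    rw [Prod.norm_def, Prod.norm_def, Real.norm_eq_abs, Real.norm_eq_abs, Real.norm_eq_abs]
    simp only [hMdef]
    exact max_le (by linarith) (max_le (by linarith) (by linarith))
  have hMt : Filter.Tendsto M (Filter.cocompact _) Filter.atTop :=
    Filter.tendsto_atTop_mono hnorm (tendsto_norm_cocompact_atTop)
  have hKt : Filter.Tendsto (fun g => M g ^ (1 / 16 : ℝ)) (Filter.cocompact _) Filter.atTop :=
    (tendsto_rpow_atTop (by norm_num)).comp hMt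
  have hpoly : Filter.Tendsto (fun K : ℝ => K ^ 15 * (A - v 9 / 24 * K) + B) Filter.atTop
      Filter.atBot := by
    refine Filter.tendsto_atBot_add_const_right _ _ ?_
    refine (Filter.tendsto_pow_atTop (by norm_num)).atTop_mul_atBot₀ ?_
    simp only [sub_eq_add_neg]
    refine Filter.tendsto_atBot_add_const_left _ _ ?_
    exact Filter.tendsto_neg_atTop_atBot.comp
      (Filter.tendsto_id.const_mul_atTop (by positivity))
  refine Filter.tendsto_atBot_mono (fun g => h g (M g ^ (1 / 16 : ℝ)) ?_ ?_) (hpoly.comp hKt)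
  · exact Real.one_le_rpow (hM1 g) (by norm_num)
  · rw [← Real.rpow_mul_natCast (zero_le_one.trans (hM1 g))]
    norm_num [hMdef]

/-! ### Convexity and invariance of the orbit supremum. -/

theorem continuous_seedFunction_thetaMatrix (v : Fin 10 → ℝ) :
    Continuous fun g : ℝ × ℝ × ℝ => seedFunction ((thetaMatrix g.1 g.2.1 g.2.2).mulVec v) :=
  continuous_seedFunction.comp (continuous_thetaMatrix.matrix_mulVec continuous_const)

/-- A continuous function tending to `-∞` off compact sets attains its maximum; in particular the
`⨆` in `orbitSup` is a true supremum and not a default value. -/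
theorem exists_isMax_seedFunction (v : Fin 10 → ℝ) (hv : 0 < v 9) :
    ∃ g : ℝ × ℝ × ℝ, orbitSup v = seedFunction ((thetaMatrix g.1 g.2.1 g.2.2).mulVec v) ∧
      ∀ a b c, seedFunction ((thetaMatrix a b c).mulVec v) ≤ orbitSup v := by
  obtain ⟨g, hg⟩ := (continuous_seedFunction_thetaMatrix v).exists_forall_ge
    (tendsto_seedFunction_thetaMatrix v hv)
  have hsup : orbitSup v = seedFunction ((thetaMatrix g.1 g.2.1 g.2.2).mulVec v) :=
    le_antisymm (ciSup_le hg)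
      (le_ciSup (f := fun g : ℝ × ℝ × ℝ =>
        seedFunction ((thetaMatrix g.1 g.2.1 g.2.2).mulVec v)) ⟨_, Set.forall_mem_range.2 hg⟩ g)
  exact ⟨g, hsup, fun a b c => hsup ▸ hg (a, b, c)⟩

theorem seedFunction_le_orbitSup {v : Fin 10 → ℝ} (hv : 0 < v 9) :
    seedFunction v ≤ orbitSup v := by
  obtain ⟨_, _, h⟩ := exists_isMax_seedFunction v hv
  simpa [thetaMatrix_zero] using h 0 0 0

theorem convexOn_orbitSup : ConvexOn ℝ {v : Fin 10 → ℝ | 0 < v 9} orbitSup := by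
  have hconv : Convex ℝ {v : Fin 10 → ℝ | 0 < v 9} :=
    convex_halfSpace_gt (f := fun v : Fin 10 → ℝ => v 9) ⟨fun _ _ => rfl, fun _ _ => rfl⟩ 0
  refine ⟨hconv, fun v hv w hw α β hα hβ hαβ => ?_⟩
  obtain ⟨g, hg, -⟩ := exists_isMax_seedFunction _ (hconv hv hw hα hβ hαβ)
  obtain ⟨-, -, hv'⟩ := exists_isMax_seedFunction v hv
  obtain ⟨-, -, hw'⟩ := exists_isMax_seedFunction w hw
  rw [hg, Matrix.mulVec_add, Matrix.mulVec_smul, Matrix.mulVec_smul]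
  refine (seedFunction_convex_comb_le _ _ hα hβ hαβ).trans ?_
  exact add_le_add (mul_le_mul_of_nonneg_left (hv' _ _ _) hα)
    (mul_le_mul_of_nonneg_left (hw' _ _ _) hβ)

/-- A finite convex function on an open set in finite dimension is continuous. -/
theorem continuousOn_orbitSup : ContinuousOn orbitSup {v : Fin 10 → ℝ | 0 < v 9} :=
  convexOn_orbitSup.continuousOn (isOpen_lt continuous_const (continuous_apply 9))

theorem thetaMatrix_mulVec_single_zero (a b c k : ℝ) :
    (thetaMatrix a b c).mulVec (Pi.single 0 k) = Pi.single 0 k := by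
  ext i
  rw [Matrix.mulVec_single]
  fin_cases i <;> simp [thetaMatrix]

theorem thetaMatrix_mulVec_last (a b c : ℝ) (v : Fin 10 → ℝ) :
    (thetaMatrix a b c).mulVec v 9 = v 9 := by
  simp [Matrix.mulVec, dotProduct, Fin.sum_univ_succ, thetaMatrix]

theorem seedFunction_add_single_zero (v : Fin 10 → ℝ) (k : ℝ) :
    seedFunction (v + Pi.single 0 k) = seedFunction v - k := by
  simp [seedFunction]
  ring

theorem orbitSup_add_single_zero {v : Fin 10 → ℝ} (hv : 0 < v 9) (k : ℝ) :
    orbitSup (v + Pi.single 0 k) = orbitSup v - k := by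
  obtain ⟨g, hg, h⟩ := exists_isMax_seedFunction v hv
  obtain ⟨g', hg', h'⟩ := exists_isMax_seedFunction (v + Pi.single 0 k) (by simpa using hv)
  simp only [Matrix.mulVec_add, thetaMatrix_mulVec_single_zero, seedFunction_add_single_zero]
    at hg' h'
  refine le_antisymm ?_ ?_
  · rw [hg']
    linarith [h g'.1 g'.2.1 g'.2.2]
  · rw [hg]
    exact h' _ _ _

theorem orbitSup_thetaMatrix_mulVec {v : Fin 10 → ℝ} (hv : 0 < v 9) (a b c : ℝ) :
    orbitSup ((thetaMatrix a b c).mulVec v) = orbitSup v := by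
  have key : ∀ (w : Fin 10 → ℝ) (a b c : ℝ), 0 < w 9 →
      orbitSup ((thetaMatrix a b c).mulVec w) ≤ orbitSup w := fun w a b c hw => by
    obtain ⟨-, -, h⟩ := exists_isMax_seedFunction w hw
    refine ciSup_le fun g => ?_
    rw [Matrix.mulVec_mulVec, thetaMatrix_mul]
    exact h _ _ _
  refine le_antisymm (key v a b c hv) ?_
  -- These are the parameters of the inverse of `(a, b, c)`.
  have := key ((thetaMatrix a b c).mulVec v) (-a) (-b) (-c + a * b)
    (by rwa [thetaMatrix_mulVec_last])
  rw [Matrix.mulVec_mulVec, thetaMatrix_mul] at this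
  ring_nf at this
  rwa [thetaMatrix_zero, Matrix.one_mulVec] at this

/-- Let `A` attain the maximum at the midpoint. If `A v` and `A w` differ in a middle coordinate,
strict convexity of the seed applies. Otherwise `w = v + k e₀`, since `A` is injective and fixes
`e₀`, and equality of the suprema forces `k = 0`. -/
theorem orbitSup_midpoint_lt {v w : Fin 10 → ℝ} (hv : v 9 = 1) (hw : w 9 = 1) (hvw : v ≠ w)
    (heq : orbitSup v = orbitSup w) :
    orbitSup ((1 / 2 : ℝ) • v + (1 / 2 : ℝ) • w) < orbitSup v := by
  have hv0 : 0 < v 9 := hv ▸ one_pos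
  have hw0 : 0 < w 9 := hw ▸ one_pos
  obtain ⟨g, hg, -⟩ := exists_isMax_seedFunction ((1 / 2 : ℝ) • v + (1 / 2 : ℝ) • w)
    (by simp [hv, hw])
  obtain ⟨-, -, hv'⟩ := exists_isMax_seedFunction v hv0
  obtain ⟨-, -, hw'⟩ := exists_isMax_seedFunction w hw0
  rw [hg, Matrix.mulVec_add, Matrix.mulVec_smul, Matrix.mulVec_smul]
  set A := thetaMatrix g.1 g.2.1 g.2.2 with hA
  by_cases h : ∃ i : Fin 8, A.mulVec v i.castSucc.succ ≠ A.mulVec w i.castSucc.succ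
  · obtain ⟨i, hi⟩ := h
    linarith [seedFunction_midpoint_lt hi, hv' g.1 g.2.1 g.2.2, hw' g.1 g.2.1 g.2.2]
  · push Not at h
    exfalso
    set k := A.mulVec w 0 - A.mulVec v 0 with hk
    have hAeq : A.mulVec w = A.mulVec (v + Pi.single 0 k) := by
      rw [Matrix.mulVec_add, hA, thetaMatrix_mulVec_single_zero, ← hA]
      ext i
      refine Fin.cases ?_ (fun i => Fin.lastCases ?_ (fun i => ?_) i) i
      · simp [hk]
      · have h1 := thetaMatrix_mulVec_last g.1 g.2.1 g.2.2 v
        have h2 := thetaMatrix_mulVec_last g.1 g.2.1 g.2.2 w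
        rw [← hA] at h1 h2
        change A.mulVec w 9 = A.mulVec v 9 + (Pi.single 0 k : Fin 10 → ℝ) 9
        simp [h1, h2, hv, hw]
      · simp [h i]
    have hinj : Function.Injective A.mulVec :=
      Matrix.mulVec_injective_of_isUnit ((Matrix.isUnit_iff_isUnit_det _).2
        (by rw [hA, thetaMatrix_det]; exact isUnit_one))
    have hwv := hinj hAeq
    have := orbitSup_add_single_zero hv0 k
    rw [← hwv, ← heq] at this
    have hk0 : k = 0 := by linarith
    rw [hk0, Pi.single_zero, add_zero] at hwv
    exact hvw hwv.symm

/-! ### Projective transformations and the Hilbert metric -/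

instance projectiveContinuousConstSMul (n : ℕ) :
    ContinuousConstSMul SL(n, ℝ) (ℙ ℝ (Fin n → ℝ)) where
  continuous_const_smul g := by
    refine continuous_coinduced_dom.2 ?_
    have hcont : Continuous fun v : { v : Fin n → ℝ // v ≠ 0 } =>
        (⟨g • v.1, (smul_ne_zero_iff_ne g).2 v.2⟩ : { v : Fin n → ℝ // v ≠ 0 }) :=
      Continuous.subtype_mk (Continuous.matrix_mulVec continuous_const continuous_subtype_val) _
    exact continuous_coinduced_rng.comp hcont

/-- A linear map preserves the coefficients of a combination of `u` and `v`, and as a homeomorphism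
it carries frontier to frontier, so the same cross-ratio occurs. -/
theorem hilbertDist_witness_smul {n : ℕ} (g : SL(n, ℝ)) (Ω : Set (ℙ ℝ (Fin n → ℝ)))
    (x y : ℙ ℝ (Fin n → ℝ)) {r : ℝ}
    (h : ∃ (u v : Fin n → ℝ) (hu : u ≠ 0) (hv : v ≠ 0),
      x = Projectivization.mk ℝ u hu ∧ y = Projectivization.mk ℝ v hv ∧ x ≠ y ∧
      ∃ (s t s' t' : ℝ) (h : s • u + t • v ≠ 0) (h' : s' • u + t' • v ≠ 0),
        Projectivization.mk ℝ _ h ∈ frontier Ω ∧ Projectivization.mk ℝ _ h' ∈ frontier Ω ∧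
        Projectivization.mk ℝ _ h ≠ Projectivization.mk ℝ _ h' ∧
        r = 1 / 2 * |Real.log (abs ((s * t') / (t * s')))|) :
    ∃ (u v : Fin n → ℝ) (hu : u ≠ 0) (hv : v ≠ 0),
      g • x = Projectivization.mk ℝ u hu ∧ g • y = Projectivization.mk ℝ v hv ∧ g • x ≠ g • y ∧
      ∃ (s t s' t' : ℝ) (h : s • u + t • v ≠ 0) (h' : s' • u + t' • v ≠ 0),
        Projectivization.mk ℝ _ h ∈ frontier (g • Ω) ∧
        Projectivization.mk ℝ _ h' ∈ frontier (g • Ω) ∧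
        Projectivization.mk ℝ _ h ≠ Projectivization.mk ℝ _ h' ∧
        r = 1 / 2 * |Real.log (abs ((s * t') / (t * s')))| := by
  obtain ⟨u, v, hu, hv, rfl, rfl, hne, s, t, s', t', h, h', hf, hf', hff, hr⟩ := h
  have hcomb : ∀ s t : ℝ, s • g • u + t • g • v = g • (s • u + t • v) := fun s t => by
    rw [smul_add, smul_comm g s, smul_comm g t]
  have hmk : ∀ (s t : ℝ) (h : s • u + t • v ≠ 0) (hg : s • g • u + t • g • v ≠ 0),
      Projectivization.mk ℝ (s • g • u + t • g • v) hg =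
        g • Projectivization.mk ℝ (s • u + t • v) h := fun s t h hg => by
    simp only [hcomb, Projectivization.smul_mk]
  have hfr : frontier (g • Ω) = g • frontier Ω := ((Homeomorph.smul g).image_frontier Ω).symm
  have hg : s • g • u + t • g • v ≠ 0 := by
    rw [hcomb]
    exact (smul_ne_zero_iff_ne g).2 h
  have hg' : s' • g • u + t' • g • v ≠ 0 := by
    rw [hcomb]
    exact (smul_ne_zero_iff_ne g).2 h'
  refine ⟨g • u, g • v, (smul_ne_zero_iff_ne g).2 hu, (smul_ne_zero_iff_ne g).2 hv, rfl, rfl,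
    fun hxy => hne (smul_left_cancel g hxy), s, t, s', t', hg, hg', ?_, ?_, ?_, hr⟩
  · rw [hmk s t h, hfr]
    exact Set.smul_mem_smul_set hf
  · rw [hmk s' t' h', hfr]
    exact Set.smul_mem_smul_set hf'
  · rw [hmk s t h, hmk s' t' h']
    exact fun heq => hff (smul_left_cancel g heq)

theorem hilbertDist_smul {n : ℕ} (g : SL(n, ℝ)) (Ω : Set (ℙ ℝ (Fin n → ℝ)))
    (x y : ℙ ℝ (Fin n → ℝ)) : hilbertDist (g • Ω) (g • x) (g • y) = hilbertDist Ω x y := by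
  refine congrArg sSup (Set.ext fun r => ⟨fun h => ?_, hilbertDist_witness_smul g Ω x y⟩)
  simpa using hilbertDist_witness_smul g⁻¹ (g • Ω) (g • x) (g • y) h

theorem hilbertDist_nonneg {n : ℕ} (Ω : Set (ℙ ℝ (Fin n → ℝ))) (x y : ℙ ℝ (Fin n → ℝ)) :
    0 ≤ hilbertDist Ω x y := by
  refine Real.sSup_nonneg ?_
  rintro r ⟨u, v, hu, hv, -, -, -, s, t, s', t', h, h', -, -, -, rfl⟩
  positivity

/-- If the line through `[u]` and `[v]` lies in `Ω` up to far beyond these points, then their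
Hilbert distance is small. -/
theorem hilbertDist_mk_le {n : ℕ} {Ω : Set (ℙ ℝ (Fin n → ℝ))} (hΩ : IsOpen Ω)
    {u v : Fin n → ℝ} (hu : u ≠ 0) (hv : v ≠ 0) {T : ℝ} (hT : 1 < T)
    (h : ∀ τ : ℝ, |τ| ≤ T → ∃ hw : u + τ • (v - u) ≠ 0,
      Projectivization.mk ℝ (u + τ • (v - u)) hw ∈ Ω) :
    hilbertDist Ω (Projectivization.mk ℝ u hu) (Projectivization.mk ℝ v hv) ≤
      -Real.log (1 - 1 / T) := by
  have hT0 : 0 < T := zero_lt_one.trans hT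
  have hT1 : 1 / T < 1 := (div_lt_one hT0).2 hT
  have hTp : 0 < 1 / T := by positivity
  have hlog : 0 ≤ -Real.log (1 - 1 / T) := by
    rw [neg_nonneg]
    exact Real.log_nonpos (by linarith) (by linarith)
  -- The coordinates of a boundary point are almost opposite.
  have key : ∀ (s t : ℝ) (hst : s • u + t • v ≠ 0),
      Projectivization.mk ℝ (s • u + t • v) hst ∈ frontier Ω →
        |Real.log (abs (s / t))| ≤ -Real.log (1 - 1 / T) := by
    intro s t hst hf
    have hnot : Projectivization.mk ℝ (s • u + t • v) hst ∉ Ω := by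
      rw [hΩ.frontier_eq] at hf
      exact hf.2
    -- If `s + t ≠ 0`, the point is `[u + τ (v - u)]` with `τ = t / (s + t)`, so lying outside `Ω`
    -- forces `|τ| > T`.
    have hbound : |s + t| * T ≤ |t| := by
      by_contra! hlt
      have hst0 : s + t ≠ 0 := by
        intro h0
        rw [h0, abs_zero, zero_mul] at hlt
        exact absurd hlt (abs_nonneg t).not_gt
      obtain ⟨hw, hmem⟩ := h (t / (s + t)) (by
        rw [abs_div, div_le_iff₀ (abs_pos.2 hst0), mul_comm]
        exact hlt.le)
      apply hnot
      convert hmem using 1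
      rw [Projectivization.mk_eq_mk_iff']
      refine ⟨s + t, ?_⟩
      rw [smul_add, smul_smul, mul_div_cancel₀ _ hst0, smul_sub, add_smul]
      abel
    have ht0 : t ≠ 0 := by
      rintro rfl
      rw [abs_zero, add_zero] at hbound
      have : |s| ≤ 0 := by nlinarith [abs_nonneg s]
      apply hst
      rw [abs_nonpos_iff.1 this]
      simp
    have htp := abs_pos.2 ht0
    have hσ : |s / t + 1| ≤ 1 / T := by
      rw [div_add_one ht0, abs_div, div_le_div_iff₀ htp hT0]
      linarith
    have hσ' := abs_le.1 hσ
    have habs : |s / t| = -(s / t) := abs_of_neg (by linarith)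
    rw [habs, abs_le, neg_neg]
    constructor
    · exact Real.log_le_log (by linarith) (by linarith)
    · rw [← Real.log_inv]
      refine Real.log_le_log (by linarith) ?_
      rw [← one_div, le_div_iff₀ (by linarith)]
      -- Here `-(s / t) ≤ 1 + 1 / T` and `(1 + 1 / T) * (1 - 1 / T) ≤ 1`.
      nlinarith
  refine Real.sSup_le ?_ hlog
  rintro r ⟨u', v', hu', hv', hxu, hyv, -, s, t, s', t', hst, hst', hf, hf', -, rfl⟩
  obtain ⟨α, rfl⟩ := (Projectivization.mk_eq_mk_iff' ℝ _ _ hu' hu).1 hxu.symm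
  obtain ⟨β, rfl⟩ := (Projectivization.mk_eq_mk_iff' ℝ _ _ hv' hv).1 hyv.symm
  have hα : α ≠ 0 := fun h0 => hu' (by rw [h0, zero_smul])
  have hβ : β ≠ 0 := fun h0 => hv' (by rw [h0, zero_smul])
  simp only [smul_smul] at hf hf'
  have h1 := key _ _ _ hf
  have h2 := key _ _ _ hf'
  have hratio : |s * t' / (t * s')| = |s * α / (t * β)| / |s' * α / (t' * β)| := by
    rw [← abs_div]
    congr 1
    field_simp
  rw [hratio]
  -- In the degenerate cases the convention `Real.log 0 = 0` makes the value zero.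
  by_cases ha : |s * α / (t * β)| = 0
  · rw [ha, zero_div, Real.log_zero, abs_zero, mul_zero]
    exact hlog
  by_cases hb : |s' * α / (t' * β)| = 0
  · rw [hb, div_zero, Real.log_zero, abs_zero, mul_zero]
    exact hlog
  rw [Real.log_div ha hb]
  linarith [abs_sub (Real.log |s * α / (t * β)|) (Real.log |s' * α / (t' * β)|)]

/-! ### The invariant domain -/

theorem isOpen_projective_iff {n : ℕ} {S : Set (ℙ ℝ (Fin n → ℝ))} :
    IsOpen S ↔ IsOpen (Projectivization.mk' ℝ ⁻¹' S) :=
  Iff.rfl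

/-- The representative with last coordinate `1` of a vector with nonzero last coordinate. -/
noncomputable def affineChart (v : Fin 10 → ℝ) : Fin 10 → ℝ := (v 9)⁻¹ • v

theorem affineChart_last {v : Fin 10 → ℝ} (hv : v 9 ≠ 0) : affineChart v 9 = 1 := by
  simp [affineChart, hv]

theorem affineChart_of_last_eq_one {v : Fin 10 → ℝ} (hv : v 9 = 1) : affineChart v = v := by
  simp [affineChart, hv]

theorem smul_affineChart {v : Fin 10 → ℝ} (hv : v 9 ≠ 0) : v 9 • affineChart v = v :=
  smul_inv_smul₀ hv v

theorem affineChart_smul {r : ℝ} (hr : r ≠ 0) (v : Fin 10 → ℝ) :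
    affineChart (r • v) = affineChart v := by
  rw [affineChart, affineChart, smul_smul, Pi.smul_apply, smul_eq_mul, mul_inv_rev, mul_assoc,
    inv_mul_cancel₀ hr, mul_one]

/-- The points of the affine patch at which the supremum over the orbit lies in a given set. -/
def orbitSupPreimage (U : Set ℝ) : Set (ℙ ℝ (Fin 10 → ℝ)) :=
  {p | p.rep 9 ≠ 0 ∧ orbitSup (affineChart p.rep) ∈ U}

theorem mk_mem_orbitSupPreimage {U : Set ℝ} {v : Fin 10 → ℝ} (hv : v ≠ 0) :
    Projectivization.mk ℝ v hv ∈ orbitSupPreimage U ↔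
      v 9 ≠ 0 ∧ orbitSup (affineChart v) ∈ U := by
  obtain ⟨r, hr⟩ := Projectivization.exists_smul_eq_mk_rep ℝ v hv
  rw [orbitSupPreimage, Set.mem_ofPred_eq, ← hr, Units.smul_def, affineChart_smul r.ne_zero]
  simp

theorem isOpen_orbitSupPreimage {U : Set ℝ} (hU : IsOpen U) : IsOpen (orbitSupPreimage U) := by
  rw [isOpen_projective_iff]
  have hopen : IsOpen {v : Fin 10 → ℝ | v 9 ≠ 0} :=
    isOpen_ne_fun (continuous_apply 9) continuous_const
  have hchart : ContinuousOn affineChart {v : Fin 10 → ℝ | v 9 ≠ 0} :=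
    ((continuous_apply 9).continuousOn.inv₀ fun _ h => h).smul continuousOn_id
  have hcont : ContinuousOn (fun v => orbitSup (affineChart v)) {v : Fin 10 → ℝ | v 9 ≠ 0} :=
    continuousOn_orbitSup.comp hchart fun v hv => by simp [affineChart_last hv]
  convert (hcont.isOpen_inter_preimage hopen hU).preimage
    (continuous_subtype_val (p := fun v : Fin 10 → ℝ => v ≠ 0)) using 1
  ext ⟨v, hv⟩
  exact mk_mem_orbitSupPreimage hv

/-- The strictly convex domain preserved by the Heisenberg group. -/
def heisenbergDomain : Set (ℙ ℝ (Fin 10 → ℝ)) := orbitSupPreimage (Set.Iio 0)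

theorem isOpen_heisenbergDomain : IsOpen heisenbergDomain := isOpen_orbitSupPreimage isOpen_Iio

theorem mk_mem_heisenbergDomain {v : Fin 10 → ℝ} (hv : v ≠ 0) :
    Projectivization.mk ℝ v hv ∈ heisenbergDomain ↔
      v 9 ≠ 0 ∧ orbitSup (affineChart v) < 0 :=
  mk_mem_orbitSupPreimage hv

theorem ne_zero_of_last_eq_one {v : Fin 10 → ℝ} (hv : v 9 = 1) : v ≠ 0 := by
  rintro rfl
  simp at hv

theorem mk_mem_heisenbergDomain_of_last_eq_one {v : Fin 10 → ℝ} (hv : v 9 = 1) :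
    Projectivization.mk ℝ v (ne_zero_of_last_eq_one hv) ∈ heisenbergDomain ↔ orbitSup v < 0 := by
  rw [mk_mem_heisenbergDomain, affineChart_of_last_eq_one hv]
  simp [hv]

theorem single_last_add_single_zero_last (k : ℝ) :
    (Pi.single 9 1 + Pi.single 0 k : Fin 10 → ℝ) 9 = 1 := by
  simp

theorem heisenbergDomain_nonempty : heisenbergDomain.Nonempty := by
  refine ⟨_, (mk_mem_heisenbergDomain_of_last_eq_one
    (single_last_add_single_zero_last (orbitSup (Pi.single 9 1) + 1))).2 ?_⟩
  rw [orbitSup_add_single_zero (by simp)]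
  linarith

/-! ### Closure and frontier of the domain. -/

/-- The homogeneous form of the inequality `|v i| ^ (5 / 4) ≤ v 0` on the affine patch. -/
def EpigraphBound (v : Fin 10 → ℝ) : Prop :=
  (∀ i : Fin 8, |v i.castSucc.succ| ^ (5 / 4 : ℝ) ≤ |v 0| * |v 9| ^ (1 / 4 : ℝ)) ∧ 0 ≤ v 0 * v 9

theorem EpigraphBound.smul {v : Fin 10 → ℝ} (h : EpigraphBound v) (r : ℝ) :
    EpigraphBound (r • v) := by
  have hr : |r| ^ (5 / 4 : ℝ) = |r| * |r| ^ (1 / 4 : ℝ) := by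
    rw [show (5 / 4 : ℝ) = 1 + 1 / 4 by norm_num,
      Real.rpow_add_of_nonneg (abs_nonneg r) (by norm_num) (by norm_num), Real.rpow_one]
  refine ⟨fun i => ?_, ?_⟩
  · simp only [Pi.smul_apply, smul_eq_mul, abs_mul]
    rw [Real.mul_rpow (abs_nonneg _) (abs_nonneg _), Real.mul_rpow (abs_nonneg _) (abs_nonneg _),
      hr]
    calc _ ≤ |r| * |r| ^ (1 / 4 : ℝ) * (|v 0| * |v 9| ^ (1 / 4 : ℝ)) :=
          mul_le_mul_of_nonneg_left (h.1 i) (by positivity)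
      _ = _ := by ring
  · simp only [Pi.smul_apply, smul_eq_mul]
    calc 0 ≤ r ^ 2 * (v 0 * v 9) := mul_nonneg (sq_nonneg r) h.2
      _ = _ := by ring

/-- At `v 9 = 0` the positive power of `|v 9|` kills the middle coordinates. If `v 0 + v 9 = 0`,
then `0 ≤ v 0 * v 9` gives `v 9 = 0` again; thus the hyperplane `v 0 + v 9 = 0` will miss the
closure. -/
theorem EpigraphBound.eq_single_zero {v : Fin 10 → ℝ} (h : EpigraphBound v)
    (h0 : v 9 = 0 ∨ v 0 + v 9 = 0) : v = Pi.single 0 (v 0) ∧ v 9 = 0 := by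
  have h9 : v 9 = 0 := by
    rcases h0 with h0 | h0
    · exact h0
    · have := h.2
      nlinarith [sq_nonneg (v 9)]
  refine ⟨?_, h9⟩
  ext i
  refine Fin.cases ?_ (fun i => Fin.lastCases ?_ (fun i => ?_) i) i
  · simp
  · change v 9 = (Pi.single 0 (v 0) : Fin 10 → ℝ) 9
    simp [h9]
  · have hi := h.1 i
    rw [h9, abs_zero, Real.zero_rpow (by norm_num), mul_zero] at hi
    have hz := (Real.rpow_eq_zero (abs_nonneg _) (by norm_num)).1
      (le_antisymm hi (by positivity))
    simpa using hz

theorem epigraphBound_of_orbitSup_neg {v : Fin 10 → ℝ} (hv : v 9 = 1) (h : orbitSup v < 0) :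
    EpigraphBound v := by
  have hs := (seedFunction_le_orbitSup (v := v) (by rw [hv]; exact one_pos)).trans_lt h
  rw [seedFunction] at hs
  have hnn : ∀ i : Fin 8, 0 ≤ |v i.castSucc.succ| ^ (5 / 4 : ℝ) := fun i => by positivity
  have h0 : 0 ≤ v 0 := by linarith [Finset.sum_nonneg fun i (_ : i ∈ Finset.univ) => hnn i]
  refine ⟨fun i => ?_, by simpa [hv] using h0⟩
  have := Finset.single_le_sum (fun i _ => hnn i) (Finset.mem_univ i)
  rw [hv, abs_one, Real.one_rpow, mul_one, abs_of_nonneg h0]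
  linarith

/-- The bound is closed and invariant under scaling, so it defines a closed set of projective points
containing the domain. -/
theorem epigraphBound_of_mem_closure {v : Fin 10 → ℝ} (hv : v ≠ 0)
    (h : Projectivization.mk ℝ v hv ∈ closure heisenbergDomain) : EpigraphBound v := by
  have hmk : ∀ (w : Fin 10 → ℝ) (hw : w ≠ 0),
      EpigraphBound (Projectivization.mk ℝ w hw).rep ↔ EpigraphBound w := fun w hw => by
    obtain ⟨r, hr⟩ := Projectivization.exists_smul_eq_mk_rep ℝ w hw
    rw [← hr, Units.smul_def]
    refine ⟨fun h => ?_, fun h => h.smul _⟩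
    simpa using h.smul (r : ℝ)⁻¹
  have hclosed : IsClosed {p : ℙ ℝ (Fin 10 → ℝ) | EpigraphBound p.rep} := by
    rw [← isOpen_compl_iff, isOpen_projective_iff, Set.preimage_compl, isOpen_compl_iff]
    have hc : IsClosed {v : Fin 10 → ℝ | EpigraphBound v} := by
      simp only [EpigraphBound, Set.ofPred_and, Set.ofPred_forall]
      refine (isClosed_iInter fun i => isClosed_le ?_ ?_).inter
        (isClosed_le continuous_const ((continuous_apply _).mul (continuous_apply _)))
      · exact (continuous_apply _).abs.rpow_const fun _ => Or.inr (by norm_num)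
      · exact (continuous_apply _).abs.mul
          ((continuous_apply _).abs.rpow_const fun _ => Or.inr (by norm_num))
    convert hc.preimage (continuous_subtype_val (p := fun v : Fin 10 → ℝ => v ≠ 0)) using 1
    ext ⟨w, hw⟩
    exact hmk w hw
  have hsub : heisenbergDomain ⊆ {p : ℙ ℝ (Fin 10 → ℝ) | EpigraphBound p.rep} := fun p hp => by
    have hb := epigraphBound_of_orbitSup_neg (affineChart_last hp.1) hp.2
    have := hb.smul (p.rep 9)
    rwa [smul_affineChart hp.1] at this
  exact (hmk v hv).1 (closure_minimal hsub hclosed h)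

theorem orbitSup_nonpos_of_mem_closure {v : Fin 10 → ℝ} (hv : v ≠ 0) (h9 : v 9 ≠ 0)
    (h : Projectivization.mk ℝ v hv ∈ closure heisenbergDomain) :
    orbitSup (affineChart v) ≤ 0 := by
  by_contra! hpos
  -- The locus `F > 0` in the affine patch is open and disjoint from the domain.
  obtain ⟨p, hp, hp'⟩ := mem_closure_iff.1 h _ (isOpen_orbitSupPreimage isOpen_Ioi)
    ((mk_mem_orbitSupPreimage (U := Set.Ioi 0) hv).2 ⟨h9, hpos⟩)
  exact lt_asymm (Set.mem_Ioi.1 hp.2) (Set.mem_Iio.1 hp'.2)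

theorem mem_frontier_heisenbergDomain {v : Fin 10 → ℝ} (hv : v ≠ 0)
    (h : Projectivization.mk ℝ v hv ∈ frontier heisenbergDomain) :
    (v = Pi.single 0 (v 0) ∧ v 9 = 0) ∨ (v 9 ≠ 0 ∧ orbitSup (affineChart v) = 0) := by
  rw [isOpen_heisenbergDomain.frontier_eq] at h
  by_cases h9 : v 9 = 0
  · exact Or.inl ((epigraphBound_of_mem_closure hv h.1).eq_single_zero (Or.inl h9))
  · refine Or.inr ⟨h9, le_antisymm (orbitSup_nonpos_of_mem_closure hv h9 h.1) ?_⟩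
    by_contra! hneg
    exact h.2 ((mk_mem_heisenbergDomain hv).2 ⟨h9, hneg⟩)

theorem isProperlyConvexDomain_heisenbergDomain : IsProperlyConvexDomain heisenbergDomain := by
  refine ⟨isOpen_heisenbergDomain, heisenbergDomain_nonempty,
    LinearMap.proj (R := ℝ) (φ := fun _ : Fin 10 => ℝ) 0 + LinearMap.proj 9, fun v hv h hφ => ?_, ?_⟩
  · have hsum : v 0 + v 9 = 0 := hφ
    obtain ⟨h1, h2⟩ :=
      (epigraphBound_of_mem_closure hv h).eq_single_zero (Or.inr hsum)
    rw [h2, add_zero] at hsum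
    rw [hsum, Pi.single_zero] at h1
    exact hv h1
  · have hpos : ∀ v : Fin 10 → ℝ, v 0 + v 9 = 1 → ∀ hv : v ≠ 0,
        Projectivization.mk ℝ v hv ∈ heisenbergDomain →
          0 < v 9 ∧ orbitSup (affineChart v) < 0 := fun v hφ hv hmem => by
      obtain ⟨h9, hneg⟩ := (mk_mem_heisenbergDomain hv).1 hmem
      refine ⟨?_, hneg⟩
      have := (epigraphBound_of_mem_closure hv (subset_closure hmem)).2
      by_contra! hle
      have hlt := lt_of_le_of_ne hle h9
      nlinarith
    rintro v ⟨hφv, hv, hmv⟩ w ⟨hφw, hw, hmw⟩ α β hα hβ hαβ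
    change v 0 + v 9 = 1 at hφv
    change w 0 + w 9 = 1 at hφw
    obtain ⟨hv9, hvn⟩ := hpos v hφv hv hmv
    obtain ⟨hw9, hwn⟩ := hpos w hφw hw hmw
    set z := α • v + β • w with hz
    have hz9 : z 9 = α * v 9 + β * w 9 := rfl
    have hz9pos : 0 < z 9 := by
      rw [hz9]
      rcases hα.eq_or_lt with rfl | hα'
      · have : β = 1 := by linarith
        simpa [this] using hw9
      · exact add_pos_of_pos_of_nonneg (mul_pos hα' hv9) (mul_nonneg hβ hw9.le)
    have hz0 : z ≠ 0 := fun h => hz9pos.ne' (by rw [h]; rfl)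
    refine ⟨?_, hz0, (mk_mem_heisenbergDomain hz0).2 ⟨hz9pos.ne', ?_⟩⟩
    · change (α * v 0 + β * w 0) + (α * v 9 + β * w 9) = 1
      calc _ = α * (v 0 + v 9) + β * (w 0 + w 9) := by ring
        _ = 1 := by rw [hφv, hφw, mul_one, mul_one, hαβ]
    · have hcomb : affineChart z = (α * v 9 / z 9) • affineChart v +
          (β * w 9 / z 9) • affineChart w := by
        rw [affineChart, hz, smul_add, affineChart, affineChart, smul_smul, smul_smul, smul_smul,
          smul_smul, ← hz]
        congr 2 <;> field_simp
      have hc1 : 0 ≤ α * v 9 / z 9 := by positivity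
      have hc2 : 0 ≤ β * w 9 / z 9 := by positivity
      have hc : α * v 9 / z 9 + β * w 9 / z 9 = 1 := by
        rw [← add_div, ← hz9, div_self hz9pos.ne']
      rw [hcomb]
      refine (convexOn_orbitSup.convex_lt 0 ?_ ?_ hc1 hc2 hc).2
      · exact ⟨by simp [affineChart_last hv9.ne'], hvn⟩
      · exact ⟨by simp [affineChart_last hw9.ne'], hwn⟩

/-- On the segment choose a second point `z = v + t w`, `t > 0`, with `z 9` of the same sign as `v
9`. The affine midpoint of the two charts is again on the segment, so `F` would vanish at all three
points, against `orbitSup_midpoint_lt`. -/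
theorem not_projectiveSegment_subset_frontier {v w : Fin 10 → ℝ} (hvw : LinearIndependent ℝ ![v, w])
    (hv9 : v 9 ≠ 0) : ¬ projectiveSegment v w ⊆ frontier heisenbergDomain := by
  intro hsub
  have hne : ∀ s t : ℝ, s ≠ 0 ∨ t ≠ 0 → s • v + t • w ≠ 0 := fun s t hst h0 => by
    have := LinearIndependent.pair_iff.1 hvw s t h0
    tauto
  have hfr : ∀ s t : ℝ, 0 ≤ s → 0 ≤ t → s * v 9 + t * w 9 ≠ 0 →
      orbitSup (affineChart (s • v + t • w)) = 0 := fun s t hs ht h9 => by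
    have hst : s ≠ 0 ∨ t ≠ 0 := by
      by_contra! h
      simp [h.1, h.2] at h9
    rcases mem_frontier_heisenbergDomain (hne s t hst)
      (hsub ⟨s, t, hs, ht, hne s t hst, rfl⟩) with h | h
    · exact absurd h.2 h9
    · exact h.2
  obtain ⟨t, ρ, ht, hρ, hρt⟩ : ∃ t ρ : ℝ, 0 < t ∧ 0 < ρ ∧ v 9 + t * w 9 = ρ * v 9 := by
    rcases le_or_gt 0 (w 9 / v 9) with h | h
    · refine ⟨1, 1 + w 9 / v 9, one_pos, by linarith, ?_⟩
      field_simp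
    · have hw9 : w 9 ≠ 0 := by
        intro h0
        simp [h0] at h
      -- With opposite signs, this `t` stops where the last coordinate has dropped to half of `v 9`,
      -- before the segment reaches infinity.
      refine ⟨-(1 / (2 * (w 9 / v 9))), 1 / 2, ?_, by norm_num, ?_⟩
      · rw [neg_pos]
        exact div_neg_of_pos_of_neg one_pos (by linarith)
      · field_simp
        ring
  set z := v + t • w with hz
  have hz9 : z 9 = ρ * v 9 := hρt
  have hz9' : z 9 ≠ 0 := by
    rw [hz9]
    exact mul_ne_zero hρ.ne' hv9
  have hv0 : orbitSup (affineChart v) = 0 := by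
    simpa using hfr 1 0 zero_le_one le_rfl (by simpa using hv9)
  have hz0 : orbitSup (affineChart z) = 0 := by
    have := hfr 1 t zero_le_one ht.le (by rw [one_mul, hρt, ← hz9]; exact hz9')
    rwa [one_smul] at this
  have hchart : affineChart v ≠ affineChart z := fun h => by
    have h1 : (ρ - 1) • v + (-t) • w = 0 := by
      have h2 : ρ • v = z := by
        calc ρ • v = ρ • (v 9 • affineChart v) := by rw [smul_affineChart hv9]
          _ = z 9 • affineChart z := by rw [h, smul_smul, hz9]
          _ = z := smul_affineChart hz9'
      rw [sub_smul, h2, hz]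
      module
    exact hne _ _ (Or.inr (neg_ne_zero.2 ht.ne')) h1
  have hlt := orbitSup_midpoint_lt (affineChart_last hv9) (affineChart_last hz9') hchart
    (hv0.trans hz0.symm)
  have hmid : (1 / 2 : ℝ) • affineChart v + (1 / 2 : ℝ) • affineChart z =
      (2 * z 9)⁻¹ • ((ρ + 1) • v + t • w) := by
    rw [affineChart, affineChart, hz9, hz]
    match_scalars <;> field_simp
  have hm9 : (ρ + 1) * v 9 + t * w 9 = 2 * z 9 := by
    rw [hz9]
    linarith
  have hm := hfr (ρ + 1) t (by linarith) ht.le (by rw [hm9]; exact mul_ne_zero two_ne_zero hz9')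
  have hm' : affineChart ((ρ + 1) • v + t • w) = (2 * z 9)⁻¹ • ((ρ + 1) • v + t • w) := by
    rw [← hm9]
    rfl
  rw [hmid, ← hm', hm, hv0] at hlt
  exact lt_irrefl _ hlt

theorem projectiveSegment_comm {n : ℕ} (v w : Fin n → ℝ) :
    projectiveSegment v w = projectiveSegment w v := by
  ext p
  constructor <;> rintro ⟨s, t, hs, ht, h, rfl⟩ <;>
    exact ⟨t, s, ht, hs, by rwa [add_comm], by simp only [add_comm]⟩

theorem isStrictlyConvexDomain_heisenbergDomain : IsStrictlyConvexDomain heisenbergDomain := by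
  refine ⟨isProperlyConvexDomain_heisenbergDomain, fun v w hvw hsub => ?_⟩
  by_cases hv9 : v 9 = 0
  · by_cases hw9 : w 9 = 0
    · have hv : v ≠ 0 := by simpa using hvw.ne_zero 0
      have hw : w ≠ 0 := by simpa using hvw.ne_zero 1
      have h1 := mem_frontier_heisenbergDomain hv
        (hsub ⟨1, 0, zero_le_one, le_rfl, by simpa using hv, by simp⟩)
      have h2 := mem_frontier_heisenbergDomain hw
        (hsub ⟨0, 1, le_rfl, zero_le_one, by simpa using hw, by simp⟩)
      simp only [hv9, hw9, ne_eq, not_true_eq_false, false_and, or_false, and_true] at h1 h2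
      -- Both endpoints are multiples of `e₀`, which contradicts independence.
      have h0 := LinearIndependent.pair_iff.1 hvw (w 0) (-v 0) (by
        rw [h1, h2]
        ext i
        by_cases hi : i = 0
        · subst hi
          simp
          ring
        · simp [hi])
      rw [h0.1, Pi.single_zero] at h2
      exact hw h2
    · rw [projectiveSegment_comm] at hsub
      exact not_projectiveSegment_subset_frontier (LinearIndependent.pair_symm_iff.1 hvw) hw9 hsub
  · exact not_projectiveSegment_subset_frontier hvw hv9 hsub

/-! ### The action of the Heisenberg group -/

theorem theta_smul (h : heisenbergGroup) (v : Fin 10 → ℝ) :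
    theta h • v = (thetaMatrix (h.1 0 1) (h.1 1 2) (h.1 0 2)).mulVec v :=
  rfl

theorem heisenbergGroup_eq_one {h : heisenbergGroup} (h01 : h.1 0 1 = 0) (h12 : h.1 1 2 = 0)
    (h02 : h.1 0 2 = 0) : h = 1 := by
  obtain ⟨A, hdiag, hlow⟩ := h
  apply Subtype.ext
  apply Subtype.ext
  have h1 := hlow 1 0 (by decide)
  have h2 := hlow 2 0 (by decide)
  have h3 := hlow 2 1 (by decide)
  ext i j
  fin_cases i <;> fin_cases j <;> simp_all

theorem eq_one_of_theta_smul_eq {h : heisenbergGroup} {v : Fin 10 → ℝ} (hv : v 9 ≠ 0)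
    (hfix : theta h • v = v) : h = 1 := by
  rw [theta_smul] at hfix
  -- Rows 5, 8 and 2 read `a * v 9 = 0`, `b * v 9 = 0` and `a * v 8 + c * v 9 = 0`.
  have h5 := congrFun hfix 5
  have h8 := congrFun hfix 8
  have h2 := congrFun hfix 2
  simp [Matrix.mulVec, dotProduct, Fin.sum_univ_succ, thetaMatrix] at h5 h8 h2
  have ha := h5.resolve_right hv
  rw [ha, zero_mul, zero_add] at h2
  exact heisenbergGroup_eq_one ha (h8.resolve_right hv)
    ((mul_eq_zero.1 h2).resolve_right hv)

theorem theta_injective : Function.Injective theta := by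
  rw [injective_iff_map_eq_one]
  intro h hh
  refine eq_one_of_theta_smul_eq (v := Pi.single 9 1) (by simp) ?_
  rw [hh, one_smul]

theorem theta_smul_ne {h : heisenbergGroup} (hh : h ≠ 1) {x : ℙ ℝ (Fin 10 → ℝ)}
    (hx : x ∈ heisenbergDomain) : theta h • x ≠ x := by
  intro hfix
  induction x using Projectivization.ind with
  | h v hv =>
    obtain ⟨h9, -⟩ := (mk_mem_heisenbergDomain hv).1 hx
    rw [Projectivization.smul_mk, Projectivization.mk_eq_mk_iff'] at hfix
    obtain ⟨r, hr⟩ := hfix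
    have hr9 : r * v 9 = v 9 := by
      have := congrFun hr 9
      rwa [theta_smul, thetaMatrix_mulVec_last] at this
    rw [mul_left_eq_self₀.1 hr9 |>.resolve_right h9, one_smul] at hr
    exact hh (eq_one_of_theta_smul_eq h9 hr.symm)

theorem theta_smul_mem (h : heisenbergGroup) {x : ℙ ℝ (Fin 10 → ℝ)}
    (hx : x ∈ heisenbergDomain) : theta h • x ∈ heisenbergDomain := by
  induction x using Projectivization.ind with
  | h v hv =>
    obtain ⟨h9, hneg⟩ := (mk_mem_heisenbergDomain hv).1 hx
    have hlast : (theta h • v) 9 = v 9 := thetaMatrix_mulVec_last _ _ _ _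
    have hchart : affineChart (theta h • v) = theta h • affineChart v := by
      rw [affineChart, hlast, affineChart, smul_comm (theta h)]
    rw [Projectivization.smul_mk, mk_mem_heisenbergDomain, hlast, hchart, theta_smul,
      orbitSup_thetaMatrix_mulVec (by simp [affineChart_last h9])]
    exact ⟨h9, hneg⟩

theorem theta_smul_heisenbergDomain (h : heisenbergGroup) :
    theta h • heisenbergDomain = heisenbergDomain := by
  refine Set.Subset.antisymm ?_ fun x hx => ?_
  · rintro _ ⟨x, hx, rfl⟩
    exact theta_smul_mem h hx
  · rw [Set.mem_smul_set_iff_inv_smul_mem, ← map_inv]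
    exact theta_smul_mem h⁻¹ hx

theorem isHilbertIsometry_theta (h : heisenbergGroup) :
    IsHilbertIsometry heisenbergDomain (theta h) := fun x _ y _ => by
  conv_lhs => rw [← theta_smul_heisenbergDomain h]
  exact hilbertDist_smul _ _ _ _

theorem isUnipotentMatrix_theta (h : heisenbergGroup) : IsUnipotentMatrix (theta h) := by
  change IsNilpotent (thetaMatrix (h.1 0 1) (h.1 1 2) (h.1 0 2) - 1)
  set A := thetaMatrix (h.1 0 1) (h.1 1 2) (h.1 0 2) with hA
  have htri : A.IsUpperTriangular := by
    intro i j hij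
    fin_cases i <;> fin_cases j <;> first
      | exact absurd hij (by decide)
      | rfl
  have hdiag : ∀ i, A i i = 1 := fun i => by
    fin_cases i <;> simp [hA, thetaMatrix]
  -- Cayley–Hamilton with characteristic polynomial `(X - 1)^10`.
  have hCH := Matrix.aeval_self_charpoly A
  rw [Matrix.charpoly_of_isUpperTriangular A htri] at hCH
  simp only [hdiag, Finset.prod_const, map_pow, map_sub, Polynomial.aeval_X, map_one] at hCH
  exact ⟨_, hCH⟩

/-- The complex eigenvalues of a unipotent matrix are equal to one. -/
theorem IsUnipotentMatrix.eq_one_of_mem_spectrum {n : ℕ} {g : SL(n, ℝ)} (hg : IsUnipotentMatrix g)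
    {z : ℂ} (hz : z ∈ spectrum ℂ ((g : Matrix (Fin n) (Fin n) ℝ).map (algebraMap ℝ ℂ))) :
    z = 1 := by
  by_contra hne
  set B := (g : Matrix (Fin n) (Fin n) ℝ).map (algebraMap ℝ ℂ) with hB
  have hnil : IsNilpotent (B - 1) := by
    have := hg.map (algebraMap ℝ ℂ).mapMatrix
    rwa [map_sub, map_one] at this
  apply hz
  change IsUnit (algebraMap ℂ (Matrix (Fin n) (Fin n) ℂ) z - B)
  have hunit : IsUnit (algebraMap ℂ (Matrix (Fin n) (Fin n) ℂ) (z - 1)) :=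
    (IsUnit.mk0 _ (sub_ne_zero.2 hne)).map _
  -- Write `z - B = (z - 1) - (B - 1)`: a unit minus a commuting nilpotent.
  have := hnil.neg.isUnit_add_left_of_commute hunit
    (Algebra.commutes _ _).symm
  convert this using 1
  rw [map_sub, map_one]
  abel

theorem theta_isParabolic {h : heisenbergGroup} (hh : h ≠ 1) :
    IsParabolic heisenbergDomain (theta h) := by
  refine ⟨fun x hx => theta_smul_ne hh hx, fun z hz => ?_, ?_, fun m hm => ?_⟩
  · rw [(isUnipotentMatrix_theta h).eq_one_of_mem_spectrum hz, norm_one]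
  · rintro _ ⟨x, -, rfl⟩
    exact hilbertDist_nonneg _ _ _
  · have hbound : ∀ T : ℝ, 1 < T → m ≤ -Real.log (1 - 1 / T) := by
      intro T hT
      set e : Fin 10 → ℝ := Pi.single 9 1 with he
      set δ : Fin 10 → ℝ := theta h • e - e with hδ
      have he9 : e 9 = 1 := by simp [he]
      have hδ9 : δ 9 = 0 := by
        simp only [hδ, Pi.sub_apply, theta_smul, thetaMatrix_mulVec_last, sub_self]
      have hline9 : ∀ τ : ℝ, (e + τ • δ) 9 = 1 := fun τ => by simp [hδ9, he9]
      -- By convexity the end values bound `F` on the whole segment `e + τ δ`, `|τ| ≤ T`; shifting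
      -- by `k e₀` lowers `F` below zero there and leaves the displacement `δ` unchanged.
      set k := max (orbitSup (e + T • δ)) (orbitSup (e + (-T) • δ)) + 1 with hk
      set u : Fin 10 → ℝ := e + Pi.single 0 k with hu
      have hu9 : u 9 = 1 := single_last_add_single_zero_last k
      have hgu : theta h • u - u = δ := by
        rw [hu, smul_add, theta_smul h (Pi.single 0 k), thetaMatrix_mulVec_single_zero, hδ]
        abel
      have hmem : ∀ τ : ℝ, |τ| ≤ T → ∃ hw : u + τ • (theta h • u - u) ≠ 0,
          Projectivization.mk ℝ (u + τ • (theta h • u - u)) hw ∈ heisenbergDomain := by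
        intro τ hτ
        rw [hgu]
        have h9 : (u + τ • δ) 9 = 1 := by simp [hu9, hδ9]
        refine ⟨ne_zero_of_last_eq_one h9, (mk_mem_heisenbergDomain_of_last_eq_one h9).2 ?_⟩
        have hrw : u + τ • δ = (e + τ • δ) + Pi.single 0 k := by
          rw [hu]
          abel
        rw [hrw, orbitSup_add_single_zero (by rw [hline9]; exact one_pos)]
        have hseg : e + τ • δ ∈ segment ℝ (e + T • δ) (e + (-T) • δ) := by
          have hT0 : 0 < 2 * T := by linarith
          have hτ' := abs_le.1 hτ
          refine ⟨(T + τ) / (2 * T), (T - τ) / (2 * T), div_nonneg (by linarith) hT0.le,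
            div_nonneg (by linarith) hT0.le, by field_simp; ring, ?_⟩
          generalize δ = d, e = f
          match_scalars <;> field_simp <;> ring
        have := convexOn_orbitSup.le_on_segment (by simp [hδ9, he9]) (by simp [hδ9, he9]) hseg
        linarith
      have hu0 := ne_zero_of_last_eq_one hu9
      have humem : Projectivization.mk ℝ u hu0 ∈ heisenbergDomain := by
        obtain ⟨hw, hmem0⟩ := hmem 0 (by rw [abs_zero]; linarith)
        simpa using hmem0
      refine (hm ⟨_, humem, rfl⟩).trans ?_
      exact hilbertDist_mk_le isOpen_heisenbergDomain hu0
        ((smul_ne_zero_iff_ne (theta h)).2 hu0) hT hmem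
    have hlim : Filter.Tendsto (fun T : ℝ => -Real.log (1 - 1 / T)) Filter.atTop (nhds 0) := by
      have h1 : Filter.Tendsto (fun T : ℝ => 1 - 1 / T) Filter.atTop (nhds 1) := by
        simpa using tendsto_const_nhds.sub (tendsto_inv_atTop_zero (𝕜 := ℝ))
      simpa using (h1.log one_ne_zero).neg
    exact ge_of_tendsto hlim ((Filter.eventually_gt_atTop 1).mono hbound)

theorem mainTheorem1 :
    Function.Injective theta ∧
    ∃ Ω : Set (ℙ ℝ (Fin 10 → ℝ)),
      IsStrictlyConvexDomain Ω ∧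
      (∀ g ∈ theta.range, g • Ω = Ω) ∧
      (∀ h : heisenbergGroup, (∀ x ∈ Ω, theta h • x = x) → h = 1) ∧
      (∀ h : heisenbergGroup, IsHilbertIsometry Ω (theta h) ∧ IsUnipotentMatrix (theta h)) ∧
      (∀ h : heisenbergGroup, h ≠ 1 → IsParabolic Ω (theta h)) := by
  refine ⟨theta_injective, heisenbergDomain, isStrictlyConvexDomain_heisenbergDomain, ?_,
    fun h hfix => ?_, fun h => ⟨isHilbertIsometry_theta h, isUnipotentMatrix_theta h⟩,
    fun h hh => theta_isParabolic hh⟩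
  · rintro _ ⟨h, rfl⟩
    exact theta_smul_heisenbergDomain h
  · by_contra hh
    obtain ⟨x, hx⟩ := heisenbergDomain_nonempty
    exact theta_smul_ne hh hx (hfix x hx)
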